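/- \textbf{Setting.} Kinds are $\kappa ::= o \mid \kappa_1\to\kappa_2$. A word-generating higher-order recursion scheme $G$ has a finite set $N$ of kinded non-terminals, an initial symbol $S\in N$ of ground kind $o$, a finite set $T$ of letters of kind $o\to o$, an end marker $\$$ of kind $o$, and for every non-terminal $F:\kappa_1\to\dots\to\kappa_m\to o$ a finite, non-empty list of rules $F=\lambda x_1\dots\lambda x_m.e_i$ $(1\le i\le \ell)$, where each $e_i$ is a $\lambda$-free term of kind $o$ over $N$, $T\cup\{\$\}$ and the variables $x_j:\kappa_j$. Let $A=(Q_A,T,\delta,q_0,Q_f)$ be a non-deterministic finite automaton with language $L(A)$, and let $O:N\to\{\exists,\forall\}$ assign an owner to each non-terminal. In the game $(G,A,O)$, plays start in $S$; from a term $a_1(\cdots(a_k(F\,t_1\cdots t_m)))$ the owner of $F$ chooses a rule $F=\lambda x_1\dots\lambda x_m.e$ and the play moves to $a_1(\cdots(a_k\,e[x_1\mapsto t_1,\dots,x_m\mapsto t_m]))$. A play ends when a term $a_1(\cdots(a_k\,\$))$ is reached; Player $\exists$ wins it iff $a_1\cdots a_k\in L(A)$. Infinite plays are won by Player $\exists$.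 Player $\exists$ wins the game if she has a winning strategy. For $w\in T^*$ let $\mathrm{acc}(w)$ be the set of states from which $A$ accepts $w$, and let $\mathrm{acc}(T^*)=\{\mathrm{acc}(w): w\in T^*\}$. The abstract model has as ground domain $D_o$ the positive Boolean formulas (built from $\mathrm{true}$, atoms, $\wedge$, $\vee$) with atoms in $\mathrm{acc}(T^*)$, up to logical equivalence and ordered by implication; $D_{\kappa_1\to\kappa_2}$ is the set of functions $D_{\kappa_1}\to D_{\kappa_2}$ that preserve meets of descending chains, ordered pointwise. The end marker $\$$ is interpreted as the atom $Q_f$, a letter $a$ as the predecessor map $Q\mapsto\{q' : q'\xrightarrow{a}q \text{ for some } q\in Q\}$ on atoms, distributed over $\wedge$ and $\vee$. Let $\sigma$ be the meet $\bigsqcap_i\sigma^i$ of the Kleene approximants of the system of equations $F=\lambda x_1\dots\lambda x_m.\,\mathrm{op}_F\,e_1\cdots e_\ell$ $(F\in N)$ in this model, where $\sigma^0$ assigns the top element to each non-terminal, $\sigma^{i+1}$ is obtained by evaluating the right-hand sides at $\sigma^i$, and $\mathrm{op}_F$ is the $\ell$-ary conjunction if $O(F)=\forall$ and the $\ell$-ary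 disjunction if $O(F)=\exists$ (so $\sigma$ is the greatest solution). \textbf{Theorem.} The formula $\sigma(S)$ is satisfied by the assignment $\{Q\in\mathrm{acc}(T^*) : q_0\in Q\}$ (the set of true atoms) if and only if Player $\exists$ wins the game $(G,A,O)$. -/

import Mathlib

universe u v w

/-! ### Pointed ω-complete partial orders (for descending chains) -/

/-- A pointed partial order in which every descending chain has a greatest lower bound. -/
class Cppo (α : Type*) extends PartialOrder α, OrderTop α where
  exists_isGLB : ∀ c : ℕ → α, Antitone c → ∃ m, IsGLB (Set.range c) m

/-- The meet of a descending chain. -/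
noncomputable def Cppo.chainMeet {α : Type*} [Cppo α] (c : ℕ → α) (hc : Antitone c) : α :=
  Classical.choose (Cppo.exists_isGLB c hc)

/-- `f (⨅ cᵢ) = ⨅ f cᵢ` for every descending chain. -/
def MeetCont {α β : Type*} [Cppo α] [Cppo β] (f : α → β) : Prop :=
  ∀ (c : ℕ → α), Antitone c → ∀ m, IsGLB (Set.range c) m →
    IsGLB (Set.range fun i => f (c i)) (f m)

theorem MeetCont.monotone {α β : Type*} [Cppo α] [Cppo β] {f : α → β} (hf : MeetCont f) :
    Monotone f := by
  intro x y hxy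
  let c : ℕ → α := fun n => if n = 0 then y else x
  have hc : Antitone c := by
    intro i j hij
    by_cases hi : i = 0
    · by_cases hj : j = 0 <;> simp [c, hi, hj, hxy]
    · have hj : j ≠ 0 := by omega
      simp [c, hi, hj]
  have hm : IsGLB (Set.range c) x := by
    constructor
    · rintro _ ⟨i, rfl⟩
      by_cases hi : i = 0 <;> simp [c, hi, hxy]
    · intro b hb
      exact hb ⟨1, by simp [c]⟩
  exact (hf c hc x hm).1 ⟨0, by simp [c]⟩

/-- In a finite partial order every descending chain attains its minimum. -/
theorem exists_forall_le_of_antitone {α : Type*} [PartialOrder α] [Finite α] (c : ℕ → α)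
    (hc : Antitone c) : ∃ n, ∀ i, c n ≤ c i := by
  obtain ⟨_, ⟨n, rfl⟩, hn⟩ := (Set.toFinite (Set.range c)).exists_minimal (Set.range_nonempty c)
  refine ⟨n, fun i => ?_⟩
  exact (hn ⟨max n i, rfl⟩ (hc (le_max_left n i))).trans (hc (le_max_right n i))

/-- In a finite partial order all monotone functions are meet-continuous. -/
theorem MeetCont.of_finite {α β : Type*} [Cppo α] [Cppo β] [Finite α] {f : α → β}
    (hf : Monotone f) : MeetCont f := by
  intro c hc m hm
  obtain ⟨n, hn⟩ := exists_forall_le_of_antitone c hc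
  have h : m = c n := le_antisymm (hm.1 ⟨n, rfl⟩) (hm.2 (by rintro _ ⟨i, rfl⟩; exact hn i))
  constructor
  · rintro _ ⟨i, rfl⟩
    exact hf (hm.1 ⟨i, rfl⟩)
  · intro b hb
    rw [h]
    exact hb ⟨n, rfl⟩

instance instCppoProd {α β : Type*} [Cppo α] [Cppo β] : Cppo (α × β) where
  exists_isGLB c hc := by
    obtain ⟨m, hm⟩ := Cppo.exists_isGLB (fun i => (c i).1) (fun i j h => (hc h).1)
    obtain ⟨m', hm'⟩ := Cppo.exists_isGLB (fun i => (c i).2) (fun i j h => (hc h).2)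
    refine ⟨(m, m'), ?_⟩
    rw [isGLB_prod, ← Set.range_comp, ← Set.range_comp]
    exact ⟨hm, hm'⟩

instance instCppoPi {ι : Type*} {α : ι → Type*} [∀ i, Cppo (α i)] : Cppo (∀ i, α i) where
  exists_isGLB c hc := by
    choose m hm using fun k => Cppo.exists_isGLB (fun i => c i k) (fun i j h => hc h k)
    refine ⟨m, ?_⟩
    rw [isGLB_pi]
    intro k
    rw [← Set.range_comp]
    exact hm k

instance instCppoPUnit : Cppo PUnit where
  exists_isGLB _ _ := ⟨PUnit.unit, by constructor <;> intro <;> intros <;> trivial⟩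

/-- The meet-continuous functions from `α` to `β`. -/
structure ContFun (α β : Type*) [Cppo α] [Cppo β] where
  toFun : α → β
  cont : MeetCont toFun

namespace ContFun

variable {α β γ : Type*} [Cppo α] [Cppo β] [Cppo γ]

instance : CoeFun (ContFun α β) fun _ => α → β := ⟨ContFun.toFun⟩

@[ext] theorem ext {f g : ContFun α β} (h : ∀ x, f x = g x) : f = g := by
  cases f; cases g; congr; exact funext h

/-- The pointwise order. -/
instance : PartialOrder (ContFun α β) :=
  PartialOrder.lift (fun f => (f : α → β)) fun _ _ h => ext (congrFun h)

instance : OrderTop (ContFun α β) where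
  top := ⟨fun _ => ⊤, fun c _ m _ => by
    constructor
    · rintro _ ⟨i, rfl⟩
      exact le_rfl
    · intro b _
      exact le_top⟩
  le_top _ _ := le_top

theorem isGLB_of_pointwise {c : ℕ → ContFun α β} {m : ContFun α β}
    (h : ∀ x, IsGLB (Set.range fun i => c i x) (m x)) : IsGLB (Set.range c) m := by
  constructor
  · rintro _ ⟨i, rfl⟩ x
    exact (h x).1 ⟨i, rfl⟩
  · intro b hb x
    refine (h x).2 ?_
    rintro _ ⟨i, rfl⟩
    exact hb ⟨i, rfl⟩ x

theorem exists_pointwise (c : ℕ → ContFun α β) (hc : Antitone c) :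
    ∃ m : ContFun α β, ∀ x, IsGLB (Set.range fun i => c i x) (m x) := by
  choose m hm using fun x => Cppo.exists_isGLB (fun i => c i x) (fun i j h => hc h x)
  refine ⟨⟨m, ?_⟩, hm⟩
  intro d hd y hy
  have hmono : ∀ i, Monotone (c i) := fun i => (c i).cont.monotone
  constructor
  · rintro _ ⟨j, rfl⟩
    refine (hm _).2 ?_
    rintro _ ⟨i, rfl⟩
    exact ((hm y).1 ⟨i, rfl⟩).trans (hmono i (hy.1 ⟨j, rfl⟩))
  · intro b hb
    refine (hm y).2 ?_
    rintro _ ⟨i, rfl⟩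
    refine ((c i).cont d hd y hy).2 ?_
    rintro _ ⟨j, rfl⟩
    exact (hb ⟨j, rfl⟩).trans ((hm (d j)).1 ⟨i, rfl⟩)

instance : Cppo (ContFun α β) where
  exists_isGLB c hc := (exists_pointwise c hc).imp fun _ h => isGLB_of_pointwise h

theorem isGLB_apply {c : ℕ → ContFun α β} (hc : Antitone c) {m : ContFun α β}
    (h : IsGLB (Set.range c) m) (x : α) : IsGLB (Set.range fun i => c i x) (m x) := by
  obtain ⟨m', hm'⟩ := exists_pointwise c hc
  rw [h.unique (isGLB_of_pointwise hm')]
  exact hm' x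

end ContFun

theorem MeetCont.comp {α β γ : Type*} [Cppo α] [Cppo β] [Cppo γ] {g : β → γ} {f : α → β}
    (hg : MeetCont g) (hf : MeetCont f) : MeetCont fun x => g (f x) :=
  fun c hc m hm => hg _ (fun _ _ h => hf.monotone (hc h)) _ (hf c hc m hm)

theorem MeetCont.const {α β : Type*} [Cppo α] [Cppo β] (b : β) :
    MeetCont fun _ : α => b := by
  intro c _ m _
  rw [Set.range_const]
  exact isGLB_singleton

theorem MeetCont.id {α : Type*} [Cppo α] : MeetCont fun x : α => x :=
  fun _ _ _ hm => hm

theorem MeetCont.fst {α β : Type*} [Cppo α] [Cppo β] : MeetCont (Prod.fst : α × β → α) := by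
  intro c _ m hm
  rw [isGLB_prod, ← Set.range_comp] at hm
  exact hm.1

theorem MeetCont.snd {α β : Type*} [Cppo α] [Cppo β] : MeetCont (Prod.snd : α × β → β) := by
  intro c _ m hm
  rw [isGLB_prod, ← Set.range_comp, ← Set.range_comp] at hm
  exact hm.2

theorem MeetCont.prodMk {α β γ : Type*} [Cppo α] [Cppo β] [Cppo γ] {f : α → β} {g : α → γ}
    (hf : MeetCont f) (hg : MeetCont g) : MeetCont fun x => (f x, g x) := by
  intro c hc m hm
  rw [isGLB_prod, ← Set.range_comp, ← Set.range_comp]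
  exact ⟨hf c hc m hm, hg c hc m hm⟩

theorem MeetCont.eval {ι : Type*} {α : ι → Type*} [∀ i, Cppo (α i)] (k : ι) :
    MeetCont fun f : ∀ i, α i => f k := by
  intro c _ m hm
  rw [isGLB_pi] at hm
  have := hm k
  rwa [← Set.range_comp] at this

theorem MeetCont.pi {ι β : Type*} {α : ι → Type*} [Cppo β] [∀ i, Cppo (α i)]
    {f : β → ∀ i, α i} (h : ∀ i, MeetCont fun x => f x i) : MeetCont f := by
  intro c hc m hm
  rw [isGLB_pi]
  intro k
  rw [← Set.range_comp]
  exact h k c hc m hm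

theorem MeetCont.app {α β γ : Type*} [Cppo α] [Cppo β] [Cppo γ] {f : α → ContFun β γ}
    {g : α → β} (hf : MeetCont f) (hg : MeetCont g) : MeetCont fun x => f x (g x) := by
  intro c hc m hm
  have hfc : Antitone fun i => f (c i) := fun i j h => hf.monotone (hc h)
  have hgc : Antitone fun i => g (c i) := fun i j h => hg.monotone (hc h)
  have hfm := ContFun.isGLB_apply hfc (hf c hc m hm) (g m)
  constructor
  · rintro _ ⟨i, rfl⟩
    exact (hfm.1 ⟨i, rfl⟩).trans ((f (c i)).cont.monotone ((hg c hc m hm).1 ⟨i, rfl⟩))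
  · intro b hb
    refine hfm.2 ?_
    rintro _ ⟨i, rfl⟩
    refine ((f (c i)).cont _ hgc _ (hg c hc m hm)).2 ?_
    rintro _ ⟨j, rfl⟩
    calc b ≤ f (c (max i j)) (g (c (max i j))) := hb ⟨max i j, rfl⟩
      _ ≤ f (c i) (g (c (max i j))) := hfc (le_max_left i j) _
      _ ≤ f (c i) (g (c j)) := (f (c i)).cont.monotone (hgc (le_max_right i j))

/-- Currying of a meet-continuous function: `x ↦ (y ↦ f (x, y))`. -/
def ContFun.curry {α β γ : Type*} [Cppo α] [Cppo β] [Cppo γ] (f : ContFun (α × β) γ) :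
    ContFun α (ContFun β γ) where
  toFun x := ⟨fun y => f (x, y),
    f.cont.comp (MeetCont.prodMk (MeetCont.const x) MeetCont.id)⟩
  cont := by
    intro c hc m hm
    refine ContFun.isGLB_of_pointwise fun y => ?_
    exact (f.cont.comp (MeetCont.prodMk MeetCont.id (MeetCont.const y))) c hc m hm

/-! ### Kinds, terms, schemes -/

/-- Kinds: `κ ::= o | κ₁ → κ₂`. -/
inductive Kind : Type
  | ground : Kind
  | arr : Kind → Kind → Kind

/-- Typed positions in a list of kinds: the variables of kind `κ` in the context `Γ`. -/
inductive Var : List Kind → Kind → Type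
  | here {Γ : List Kind} {κ : Kind} : Var (κ :: Γ) κ
  | there {Γ : List Kind} {κ κ' : Kind} : Var Γ κ → Var (κ' :: Γ) κ

/-- The `λ`-free terms over non-terminals `N`, terminals `T` (families of kinded symbols, `N κ`
being the symbols of kind `κ`) and the variables in `Γ`. -/
inductive Term (N : Kind → Type*) (T : Kind → Type*) (Γ : List Kind) : Kind → Type _
  | var {κ : Kind} (x : Var Γ κ) : Term N T Γ κ
  | nonterminal {κ : Kind} (F : N κ) : Term N T Γ κ
  | terminal {κ : Kind} (s : T κ) : Term N T Γ κ
  | app {κ₁ κ₂ : Kind} (t : Term N T Γ (Kind.arr κ₁ κ₂)) (u : Term N T Γ κ₁) : Term N T Γ κ₂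

/-- Simultaneous substitution for the variables. -/
def Term.subst {N T : Kind → Type*} {Γ Δ : List Kind} (σ : ∀ κ, Var Γ κ → Term N T Δ κ) :
    ∀ {κ : Kind}, Term N T Γ κ → Term N T Δ κ
  | _, .var x => σ _ x
  | _, .nonterminal F => .nonterminal F
  | _, .terminal s => .terminal s
  | _, .app t u => .app (t.subst σ) (u.subst σ)

/-- For `κ = κ₁ → … → κₙ → o`, the context `Γ` extended by `x₁ : κ₁, …, xₙ : κₙ` (innermost
variable first): the context of the body `e` of an abstraction `λ x₁ … λ xₙ. e` of kind `κ`
with `e` of ground kind. -/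
def bodyCtx : Kind → List Kind → List Kind
  | .ground, Γ => Γ
  | .arr κ₁ κ₂, Γ => bodyCtx κ₂ (κ₁ :: Γ)

/-- The body `e` of a rule `F = λ x₁ … λ xₙ. e` for a non-terminal `F : κ`. As `κ` determines the
number and kinds of the bound variables, the body represents the rule (up to renaming of bound
variables). -/
abbrev RuleBody (N T : Kind → Type*) (κ : Kind) := Term N T (bodyCtx κ []) Kind.ground

/-- A (non-deterministic) higher-order recursion scheme over the terminals `T`: finitely many kinded
non-terminals, an initial symbol, and finitely many rules for each non-terminal. -/
structure Scheme (T : Kind → Type*) where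
  N : Kind → Type*
  finite_N : Finite (Σ κ, N κ)
  S : N Kind.ground
  rules : ∀ {κ : Kind}, N κ → List (RuleBody N T κ)

/-- A deterministic scheme: exactly one rule for each non-terminal. -/
structure DetScheme (T : Kind → Type*) where
  N : Kind → Type*
  finite_N : Finite (Σ κ, N κ)
  S : N Kind.ground
  rhs : ∀ {κ : Kind}, N κ → RuleBody N T κ

/-- The kind `o → … → o → o` of arity `n`. -/
def opKind : ℕ → Kind
  | 0 => .ground
  | n + 1 => .arr .ground (opKind n)

/-- The terminals of the determinised scheme: those of the scheme and a symbol `op_F` for each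
non-terminal `F`, the arity of which is the number of rules of `F`. -/
inductive DetTerminal {T : Kind → Type*} (G : Scheme T) : Kind → Type _
  | base {κ : Kind} (s : T κ) : DetTerminal G κ
  | op {κ : Kind} (F : G.N κ) : DetTerminal G (opKind (G.rules F).length)

/-- A scheme term seen as a term over the larger set of terminals. -/
def Term.toDet {T : Kind → Type*} {G : Scheme T} {Γ : List Kind} :
    ∀ {κ : Kind}, Term G.N T Γ κ → Term G.N (DetTerminal G) Γ κ
  | _, .var x => .var x
  | _, .nonterminal F => .nonterminal F
  | _, .terminal s => .terminal (.base s)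
  | _, .app t u => .app t.toDet u.toDet

/-- `applyList f [e₁, …, eₗ] = f e₁ ⋯ eₗ`. -/
def Term.applyList {T : Kind → Type*} {G : Scheme T} {Γ : List Kind} :
    ∀ l : List (Term G.N T Γ Kind.ground),
      Term G.N (DetTerminal G) Γ (opKind l.length) → Term G.N (DetTerminal G) Γ Kind.ground
  | [], f => f
  | e :: l, f => Term.applyList l (.app f e.toDet)

/-- The determinised scheme, with rules `F = λ x₁ … λ xₖ. op_F e₁ ⋯ eₗ`. -/
def Scheme.det {T : Kind → Type*} (G : Scheme T) : DetScheme (DetTerminal G) where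
  N := G.N
  finite_N := G.finite_N
  S := G.S
  rhs F := Term.applyList (G.rules F) (.terminal (.op F))

/-! ### Models and semantics -/

/-- A bundled cppo. -/
structure BundledCppo where
  carrier : Type*
  inst : Cppo carrier

/-- The domains of all kinds over a ground domain `D`, with
`D (κ₁ → κ₂)` the meet-continuous functions from `D κ₁` to `D κ₂`. -/
def domAux (D : Type*) [h : Cppo D] : Kind → BundledCppo
  | .ground => ⟨D, h⟩
  | .arr κ₁ κ₂ =>
    letI := (domAux D κ₁).inst
    letI := (domAux D κ₂).inst
    ⟨ContFun (domAux D κ₁).carrier (domAux D κ₂).carrier, inferInstance⟩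

/-- The domain of kind `κ`. -/
def Dom (D : Type*) [Cppo D] (κ : Kind) : Type _ := (domAux D κ).carrier

instance instCppoDom (D : Type*) [Cppo D] (κ : Kind) : Cppo (Dom D κ) := (domAux D κ).inst

/-- Elements of function kind are meet-continuous functions (by definition). -/
def Dom.toContFun {D : Type*} [Cppo D] {κ₁ κ₂ : Kind} (f : Dom D (.arr κ₁ κ₂)) :
    ContFun (Dom D κ₁) (Dom D κ₂) := f

/-- Meet-continuous functions are elements of function kind (by definition). -/
def Dom.ofContFun {D : Type*} [Cppo D] {κ₁ κ₂ : Kind} (f : ContFun (Dom D κ₁) (Dom D κ₂)) :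
    Dom D (.arr κ₁ κ₂) := f

/-- A model: a ground domain and an interpretation of the terminals. -/
structure Model (T : Kind → Type*) where
  D : Type*
  cppo : Cppo D
  interp : ∀ {κ : Kind}, T κ → Dom D κ

instance instCppoModel {T : Kind → Type*} (M : Model T) : Cppo M.D := M.cppo

/-- Valuations of the non-terminals. -/
abbrev NVal (N : Kind → Type*) (D : Type*) [Cppo D] := ∀ κ, N κ → Dom D κ

/-- Valuations of the variables in a context. -/
def Env (D : Type*) [Cppo D] (Γ : List Kind) := ∀ κ, Var Γ κ → Dom D κ

instance instCppoEnv (D : Type*) [Cppo D] (Γ : List Kind) : Cppo (Env D Γ) :=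
  inferInstanceAs (Cppo (∀ κ, Var Γ κ → Dom D κ))

/-- The valuation of no variables. -/
def Env.empty (D : Type*) [Cppo D] : Env D [] := fun _ x => nomatch x

/-- `ρ` extended by the value `d` for a new variable. -/
def Env.cons {D : Type*} [Cppo D] {Γ : List Kind} {κ : Kind} (d : Dom D κ) (ρ : Env D Γ) :
    Env D (κ :: Γ)
  | _, .here => d
  | _, .there x => ρ _ x

/-- The semantics of `λ`-free terms. -/
def Model.sem {N T : Kind → Type*} (M : Model T) {Γ : List Kind} :
    ∀ {κ : Kind}, Term N T Γ κ → NVal N M.D × Env M.D Γ → Dom M.D κ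
  | _, .var x, ν => ν.2 _ x
  | _, .nonterminal F, ν => ν.1 _ F
  | _, .terminal s, _ => M.interp s
  | _, .app t u, ν => Dom.toContFun (M.sem t ν) (M.sem u ν)

theorem Model.sem_cont {N T : Kind → Type*} (M : Model T) {Γ : List Kind} {κ : Kind}
    (t : Term N T Γ κ) : MeetCont (M.sem t) := by
  induction t with
  | var x =>
    exact ((MeetCont.eval x).comp (MeetCont.eval (α := fun κ => Var Γ κ → Dom M.D κ) _)).comp
      MeetCont.snd
  | nonterminal F =>
    exact ((MeetCont.eval F).comp (MeetCont.eval (α := fun κ => N κ → Dom M.D κ) _)).comp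
      MeetCont.fst
  | terminal s => exact MeetCont.const _
  | app t u iht ihu => exact MeetCont.app (f := fun ν => Dom.toContFun (M.sem t ν)) iht ihu

theorem Env.cons_cont {D α : Type*} [Cppo D] [Cppo α] {Γ : List Kind} {κ : Kind}
    {f : α → Dom D κ} {g : α → Env D Γ} (hf : MeetCont f) (hg : MeetCont g) :
    MeetCont fun a => Env.cons (f a) (g a) := by
  refine MeetCont.pi (α := fun κ' => Var (κ :: Γ) κ' → Dom D κ') fun κ' => MeetCont.pi fun x => ?_
  cases x with
  | here => exact hf
  | there x =>
    exact ((MeetCont.eval x).comp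
      (MeetCont.eval (α := fun κ => Var Γ κ → Dom D κ) _)).comp hg

/-- The semantics of `λ x₁ … λ xₙ. e : κ`, by iterating
`⟦λ x. t⟧ ν = (d ↦ ⟦t⟧ ν[x ↦ d])`. -/
def Model.semAbs {N T : Kind → Type*} (M : Model T) :
    ∀ (κ : Kind) (Γ : List Kind), Term N T (bodyCtx κ Γ) Kind.ground →
      ContFun (NVal N M.D × Env M.D Γ) (Dom M.D κ)
  | .ground, _, e => ⟨M.sem e, M.sem_cont e⟩
  | .arr κ₁ κ₂, Γ, e =>
    ContFun.curry (β := Dom M.D κ₁) (γ := Dom M.D κ₂)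
      ⟨fun p => M.semAbs κ₂ (κ₁ :: Γ) e (p.1.1, Env.cons p.2 p.1.2),
        (M.semAbs κ₂ (κ₁ :: Γ) e).cont.comp
          (MeetCont.prodMk (MeetCont.fst.comp MeetCont.fst)
            (Env.cons_cont MeetCont.snd (MeetCont.snd.comp MeetCont.fst)))⟩

/-- The function `rhs_M : (N → D) → (N → D)` given by the rules of a deterministic scheme. -/
def Model.rhs {T : Kind → Type*} (M : Model T) (G : DetScheme T) (ν : NVal G.N M.D) :
    NVal G.N M.D :=
  fun κ F => M.semAbs κ [] (G.rhs F) (ν, Env.empty M.D)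

/-- The Kleene approximants, starting from the greatest valuation. -/
def Model.approx {T : Kind → Type*} (M : Model T) (G : DetScheme T) : ℕ → NVal G.N M.D
  | 0 => ⊤
  | i + 1 => M.rhs G (M.approx G i)

theorem Model.rhs_mono {T : Kind → Type*} (M : Model T) (G : DetScheme T) :
    Monotone (M.rhs G) :=
  fun _ _ h _ _ => (M.semAbs _ [] _).cont.monotone ⟨h, le_rfl⟩

theorem Model.approx_antitone {T : Kind → Type*} (M : Model T) (G : DetScheme T) :
    Antitone (M.approx G) := by
  refine antitone_nat_of_succ_le fun n => ?_
  induction n with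
  | zero => exact le_top
  | succ n ih => exact M.rhs_mono G ih

/-- The semantics of a deterministic scheme in a model: the meet of the Kleene approximants. -/
noncomputable def Model.sol {T : Kind → Type*} (M : Model T) (G : DetScheme T) : NVal G.N M.D :=
  Cppo.chainMeet (M.approx G) (M.approx_antitone G)

/-! ### Higher-order games -/

/-- The terminals of a word-generating scheme: letters of kind `o → o` and the end marker. -/
inductive WordTerminal (A : Type*) : Kind → Type _
  | letter (a : A) : WordTerminal A (.arr .ground .ground)
  | endMarker : WordTerminal A .ground

inductive Player : Type
  | existential : Player
  | universal : Player

/-- A higher-order game: a word-generating scheme, an automaton with a single initial state `q₀`,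
and an ownership partitioning of the non-terminals. -/
structure HOGame (A : Type u) (Q : Type v) where
  G : Scheme.{u, w} (WordTerminal A)
  aut : NFA A Q
  q₀ : Q
  start_eq : aut.start = {q₀}
  owner : ∀ {κ : Kind}, G.N κ → Player

/-- Lists of closed argument terms `t₁, …, tₙ` for `κ = κ₁ → … → κₙ → o`. -/
inductive Args (N T : Kind → Type*) : Kind → Type _
  | nil : Args N T .ground
  | cons {κ₁ κ₂ : Kind} (t : Term N T [] κ₁) (l : Args N T κ₂) : Args N T (.arr κ₁ κ₂)

/-- The term `t t₁ ⋯ tₙ`. -/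
def Args.apply {N T : Kind → Type*} :
    ∀ {κ : Kind}, Args N T κ → Term N T [] κ → Term N T [] Kind.ground
  | _, .nil, t => t
  | _, .cons u l, t => l.apply (.app t u)

/-- The substitution `σ` extended by `[x₁ ↦ t₁, …, xₙ ↦ tₙ]`. -/
def Args.toSubst {N T : Kind → Type*} :
    ∀ {κ : Kind} {Γ : List Kind}, Args N T κ → (∀ κ', Var Γ κ' → Term N T [] κ') →
      ∀ κ', Var (bodyCtx κ Γ) κ' → Term N T [] κ'
  | _, _, .nil, σ => σ
  | _, _, .cons t l, σ => l.toSubst fun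
    | _, .here => t
    | _, .there x => σ _ x

/-- `e[x₁ ↦ t₁, …, xₙ ↦ tₙ]` for the body `e` of a rule. -/
def RuleBody.inst {N T : Kind → Type*} {κ : Kind} (e : RuleBody N T κ) (l : Args N T κ) :
    Term N T [] Kind.ground :=
  Term.subst (l.toSubst (Γ := []) fun _ x => nomatch x) e

/-- `a₁ (a₂ (⋯ (aₖ t)))` for `w = a₁ ⋯ aₖ`. -/
def prependWord {A : Type*} {N : Kind → Type*} (w : List A)
    (t : Term N (WordTerminal A) [] Kind.ground) : Term N (WordTerminal A) [] Kind.ground :=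
  w.foldr (fun a t => .app (.terminal (.letter a)) t) t

namespace HOGame

variable {A Q : Type*} (g : HOGame A Q)

/-- Positions of the game: closed `λ`-free terms of ground kind. -/
abbrev Position := Term g.G.N (WordTerminal A) [] Kind.ground

/-- It is the turn of `p` in `a₁ (⋯ (aₖ (F t₁ ⋯ tₘ)))` if `p` owns `F`. -/
def Turn (p : Player) (t : g.Position) : Prop :=
  ∃ (w : List A) (κ : Kind) (F : g.G.N κ) (l : Args g.G.N (WordTerminal A) κ),
    g.owner F = p ∧ t = prependWord w (l.apply (.nonterminal F))

/-- An (outermost-to-innermost) rewriting step, from `a₁ (⋯ (aₖ (F t₁ ⋯ tₘ)))` to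
`a₁ (⋯ (aₖ e[x₁ ↦ t₁, …, xₘ ↦ tₘ]))` for a rule `F = λ x₁ … λ xₘ. e`. -/
inductive Move : g.Position → g.Position → Prop
  | rewrite (w : List A) {κ : Kind} (F : g.G.N κ) (l : Args g.G.N (WordTerminal A) κ)
      (e : RuleBody g.G.N (WordTerminal A) κ) (he : e ∈ g.G.rules F) :
      Move (prependWord w (l.apply (.nonterminal F))) (prependWord w (e.inst l))

/-- A strategy maps the history of a play, listed with the current position first, to the next
position. -/
abbrev Strategy := List g.Position → g.Position

/-- The finite play prefixes (current position first) that start in `S` and in which Player `∃`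
follows the strategy `σ`. -/
inductive Conforms (σ : g.Strategy) : List g.Position → Prop
  | start : Conforms σ [.nonterminal g.G.S]
  | move {t t' : g.Position} {h : List g.Position} (hh : Conforms σ (t :: h)) (ht : g.Move t t')
      (hσ : g.Turn .existential t → t' = σ (t :: h)) : Conforms σ (t' :: t :: h)

/-- `σ` is a winning strategy of Player `∃`: it prescribes legal moves, and all finite maximal plays
that conform to it end in a term `a₁ (⋯ (aₖ $))` with `a₁ ⋯ aₖ` in the language of the automaton.
Infinite plays are won by Player `∃` and hence not restricted. -/
def IsWinning (σ : g.Strategy) : Prop :=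
  (∀ t h, g.Conforms σ (t :: h) → g.Turn .existential t → g.Move t (σ (t :: h))) ∧
  ∀ t h, g.Conforms σ (t :: h) → (∀ t', ¬ g.Move t t') →
    ∃ w : List A, t = prependWord w (.terminal .endMarker) ∧ w ∈ g.aut.accepts

/-- Player `∃` wins the game. -/
def ExistentialWins : Prop := ∃ σ : g.Strategy, g.IsWinning σ

end HOGame

/-! ### Positive Boolean formulas -/

/-- Positive Boolean formulas over the atomic propositions `P`. -/
inductive PosForm (P : Type*) : Type _
  | tt : PosForm P
  | atom (p : P) : PosForm P
  | and (φ ψ : PosForm P) : PosForm P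
  | or (φ ψ : PosForm P) : PosForm P

namespace PosForm

variable {P : Type*}

/-- Satisfaction of a formula by an assignment, given as the set of true propositions. -/
def Sat (I : Set P) : PosForm P → Prop
  | tt => True
  | atom p => p ∈ I
  | and φ ψ => φ.Sat I ∧ ψ.Sat I
  | or φ ψ => φ.Sat I ∨ ψ.Sat I

/-- Replacing the atomic propositions. -/
def map {P' : Type*} (f : P → P') : PosForm P → PosForm P'
  | tt => tt
  | atom p => atom (f p)
  | and φ ψ => and (φ.map f) (ψ.map f)
  | or φ ψ => or (φ.map f) (ψ.map f)

theorem sat_map {P' : Type*} (f : P → P') (I : Set P') (φ : PosForm P) :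
    (φ.map f).Sat I ↔ φ.Sat (f ⁻¹' I) := by
  induction φ with
  | tt => exact Iff.rfl
  | atom p => exact Iff.rfl
  | and φ ψ h₁ h₂ => exact and_congr h₁ h₂
  | or φ ψ h₁ h₂ => exact or_congr h₁ h₂

/-- Logical equivalence. -/
instance setoid (P : Type*) : Setoid (PosForm P) where
  r φ ψ := ∀ I, φ.Sat I ↔ ψ.Sat I
  iseqv := ⟨fun _ _ => Iff.rfl, fun h I => (h I).symm, fun h h' I => (h I).trans (h' I)⟩

end PosForm

/-- Positive Boolean formulas up to logical equivalence. -/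
def FormDom (P : Type*) := Quotient (PosForm.setoid P)

namespace FormDom

variable {P : Type*}

/-- The class of a formula. -/
def mk (φ : PosForm P) : FormDom P := Quotient.mk _ φ

/-- Satisfaction by an assignment. -/
def Sat (I : Set P) : FormDom P → Prop :=
  Quotient.lift (PosForm.Sat I) fun _ _ h => propext (h I)

theorem sat_ext {x y : FormDom P} (h : ∀ I, x.Sat I ↔ y.Sat I) : x = y := by
  induction x using Quotient.inductionOn
  induction y using Quotient.inductionOn
  exact Quotient.sound h

/-- The order is implication. -/
instance : PartialOrder (FormDom P) where
  le x y := ∀ I, x.Sat I → y.Sat I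
  le_refl _ _ h := h
  le_trans _ _ _ h h' I hx := h' I (h I hx)
  le_antisymm _ _ h h' := sat_ext fun I => ⟨h I, h' I⟩

instance : OrderTop (FormDom P) where
  top := mk .tt
  le_top _ _ _ := trivial

instance [Finite P] : Finite (FormDom P) :=
  Finite.of_injective (fun (x : FormDom P) => {I : Set P | x.Sat I}) fun _ _ h =>
    sat_ext fun I => (Set.ext_iff.1 h I)

instance instCppo [Finite P] : Cppo (FormDom P) where
  exists_isGLB c hc := by
    obtain ⟨n, hn⟩ := exists_forall_le_of_antitone c hc
    exact ⟨c n, by rintro _ ⟨i, rfl⟩; exact hn i, fun b hb => hb ⟨n, rfl⟩⟩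

/-- Conjunction. -/
def and : FormDom P → FormDom P → FormDom P :=
  Quotient.map₂ PosForm.and fun _ _ h _ _ h' I => and_congr (h I) (h' I)

/-- Disjunction. -/
def or : FormDom P → FormDom P → FormDom P :=
  Quotient.map₂ PosForm.or fun _ _ h _ _ h' I => or_congr (h I) (h' I)

/-- Replacing the atomic propositions: `f` distributed over conjunction and disjunction. -/
def map {P' : Type*} (f : P → P') : FormDom P → FormDom P' :=
  Quotient.map (PosForm.map f) fun φ ψ h I => by
    rw [PosForm.sat_map, PosForm.sat_map]
    exact h _

theorem and_mono : Monotone fun p : FormDom P × FormDom P => p.1.and p.2 := by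
  rintro ⟨x, y⟩ ⟨x', y'⟩ ⟨h, h'⟩ I
  induction x using Quotient.inductionOn
  induction y using Quotient.inductionOn
  induction x' using Quotient.inductionOn
  induction y' using Quotient.inductionOn
  exact And.imp (h I) (h' I)

theorem or_mono : Monotone fun p : FormDom P × FormDom P => p.1.or p.2 := by
  rintro ⟨x, y⟩ ⟨x', y'⟩ ⟨h, h'⟩ I
  induction x using Quotient.inductionOn
  induction y using Quotient.inductionOn
  induction x' using Quotient.inductionOn
  induction y' using Quotient.inductionOn
  exact Or.imp (h I) (h' I)

theorem map_mono {P' : Type*} (f : P → P') : Monotone (map f) := by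
  intro x y h I
  induction x using Quotient.inductionOn
  induction y using Quotient.inductionOn
  intro hx
  exact (PosForm.sat_map f I _).2 (h _ ((PosForm.sat_map f I _).1 hx))

end FormDom

/-! ### The abstract model -/

/-- `x, y₁, …, yₙ ↦ (⋯ (x ∘ y₁) ∘ ⋯) ∘ yₙ` for a binary operation `∘`. -/
def iterOp {D : Type*} [Cppo D] (b : ContFun (D × D) D) : ∀ n : ℕ, ContFun D (Dom D (opKind n))
  | 0 => ⟨fun x => x, MeetCont.id⟩
  | n + 1 => ContFun.curry (β := D) (γ := Dom D (opKind n))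
      ⟨fun p => iterOp b n (b p), (iterOp b n).cont.comp b.cont⟩

/-- The `n`-ary version of a binary operation, for `n ≥ 1` (for `n = 0` it is not used and set to
the top element). -/
def naryOp {D : Type*} [Cppo D] (b : ContFun (D × D) D) : ∀ n : ℕ, Dom D (opKind n)
  | 0 => (⊤ : Dom D .ground)
  | n + 1 => Dom.ofContFun (κ₁ := .ground) (κ₂ := opKind n) (iterOp b n)

section

variable {A Q : Type*} (M : NFA A Q)

/-- The set of states from which the word `w` is accepted. -/
def acceptFrom (w : List A) : Set Q := {q | ∃ q' ∈ M.accept, q' ∈ M.evalFrom {q} w}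

/-- The states with an `a`-transition into `X`. -/
def predStates (a : A) (X : Set Q) : Set Q := {q' | ∃ q ∈ X, q ∈ M.step q' a}

theorem acceptFrom_nil : acceptFrom M [] = M.accept := by
  ext q
  simp [acceptFrom]

theorem predStates_acceptFrom (a : A) (w : List A) :
    predStates M a (acceptFrom M w) = acceptFrom M (a :: w) := by
  ext q
  have h : M.evalFrom {q} (a :: w) = ⋃ q' ∈ M.step q a, M.evalFrom {q'} w := by
    rw [NFA.evalFrom_cons, NFA.stepSet_singleton]
    exact NFA.evalFrom_eq_biUnion_singleton M (M.step q a) w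
  simp only [predStates, acceptFrom, Set.mem_ofPred_eq, h, Set.mem_iUnion, exists_prop]
  constructor
  · rintro ⟨q', ⟨q'', hq'', hw⟩, hs⟩
    exact ⟨q'', hq'', q', hs, hw⟩
  · rintro ⟨q'', hq'', q', hs, hw⟩
    exact ⟨q', ⟨q'', hq'', hw⟩, hs⟩

/-- The atomic propositions of the abstract model: the sets of states from which some word is
accepted. -/
abbrev AccSet := {X : Set Q // ∃ w : List A, X = acceptFrom M w}

/-- The set of final states as an atomic proposition. -/
def finalAtom : AccSet M := ⟨M.accept, [], (acceptFrom_nil M).symm⟩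

/-- The `a`-predecessors of an atomic proposition. -/
def predAtom (a : A) (X : AccSet M) : AccSet M :=
  ⟨predStates M a X.1, X.2.imp' (a :: ·) fun w h => by rw [h, predStates_acceptFrom]⟩

end

/-- The abstract interpretation of the terminals: `$` is the atom `Q_f`, letters `a` are the
predecessor maps distributed over the connectives, and `op_F` is conjunction or disjunction
depending on the owner of `F`. -/
def HOGame.absInterp {A Q : Type*} [Finite Q] (g : HOGame A Q) :
    ∀ {κ : Kind}, DetTerminal g.G κ → Dom (FormDom (AccSet g.aut)) κ
  | _, .base .endMarker => FormDom.mk (.atom (finalAtom g.aut))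
  | _, .base (.letter a) => Dom.ofContFun (κ₁ := .ground) (κ₂ := .ground)
      (ContFun.mk (α := FormDom (AccSet g.aut)) (β := FormDom (AccSet g.aut))
        (FormDom.map (predAtom g.aut a)) (MeetCont.of_finite (FormDom.map_mono _)))
  | _, .op F =>
    match g.owner F with
    | .universal => naryOp ⟨fun p => p.1.and p.2, MeetCont.of_finite FormDom.and_mono⟩ _
    | .existential => naryOp ⟨fun p => p.1.or p.2, MeetCont.of_finite FormDom.or_mono⟩ _

/-- The abstract model of a game: its ground domain consists of the positive Boolean formulas over
the sets of states from which some word is accepted. -/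
def HOGame.absModel {A Q : Type*} [Finite Q] (g : HOGame A Q) : Model (DetTerminal g.G) where
  D := FormDom (AccSet g.aut)
  cppo := FormDom.instCppo
  interp := g.absInterp

/-- The value of the initial symbol of the determinised scheme in the abstract model. -/
noncomputable def HOGame.absValue {A Q : Type*} [Finite Q] (g : HOGame A Q) :
    FormDom (AccSet g.aut) :=
  g.absModel.sol g.G.det Kind.ground g.G.S

/-!
Both directions compare the game with the abstract semantics through *invariants*: sets `W` of
positions such that Player `∃` can stay in `W` at her own non-terminals, Player `∀` cannot leave `W`
at his, and terms `a₁ (⋯ (aₖ $))` in `W` spell accepted words. As infinite plays are won by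
Player `∃`, she wins if and only if `S` lies in some invariant (`HOGame.existentialWins_iff`).

If `σ(S)` is satisfied, the positions whose value under `σ` is satisfied form an invariant. Indeed
`σ` is a fixed point of the equations (`Model.rhs_sol`), so the value of `F t₁ ⋯ tₘ` is the
conjunction or disjunction of the values of its successors (`HOGame.closedSem_apply_nonterminal`),
and an enclosing letter acts on the assignment by the predecessor map
(`HOGame.satAfter_closedSem_prependWord`).

Conversely, an invariant `W` containing `S` gives rise to a logical relation `HOGame.Rel W` between
abstract values and closed terms. At ground kind it says that the value of `t` is satisfied, relative
to the word `w`, whenever `w t` lies in `W`. Top elements are related to everything, and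
evaluation of terms preserves the relation (`HOGame.rel_sem`), so by induction all Kleene approximants
of `F` are related to `F` (`HOGame.rel_approx`). As the ground domain is finite, `σ(S)` is itself
the value of an approximant at `S`.
-/

/-! ### Unique decomposition of positions -/

/-- The head of `t t₁ ⋯ tₙ` together with all its arguments, if this head is a non-terminal. -/
def Term.spine {N T : Kind → Type*} :
    ∀ {κ : Kind}, Term N T [] κ → Args N T κ → Option (Σ κ' : Kind, N κ' × Args N T κ')
  | _, .var _, _ => none
  | κ, .nonterminal F, l => some ⟨κ, F, l⟩
  | _, .terminal _, _ => none
  | _, .app t u, l => t.spine (.cons u l)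

theorem Args.spine_apply {N T : Kind → Type*} {κ : Kind} (l : Args N T κ) (t : Term N T [] κ) :
    (l.apply t).spine .nil = t.spine l := by
  induction l with
  | nil => rfl
  | cons u l ih => exact ih (.app t u)

/-- `w (F t₁ ⋯ tₘ)` determines `w`, `F` and `t₁, …, tₘ`. -/
theorem prependWord_apply_injective {A : Type*} {N : Kind → Type*} {w w' : List A} {κ κ' : Kind}
    {F : N κ} {F' : N κ'} {l : Args N (WordTerminal A) κ} {l' : Args N (WordTerminal A) κ'}
    (h : prependWord w (l.apply (.nonterminal F)) = prependWord w' (l'.apply (.nonterminal F'))) :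
    w = w' ∧ (⟨κ, F, l⟩ : Σ κ : Kind, N κ × Args N (WordTerminal A) κ) = ⟨κ', F', l'⟩ := by
  induction w generalizing w' with
  | nil =>
    have hs := congrArg (fun t => Term.spine t .nil) h
    cases w' with
    | nil =>
      refine ⟨rfl, ?_⟩
      simpa [prependWord, Args.spine_apply, Term.spine] using hs
    | cons a w' => simp [prependWord, Args.spine_apply, Term.spine] at hs
  | cons a w ih =>
    cases w' with
    | nil =>
      have hs := congrArg (fun t => Term.spine t .nil) h
      simp [prependWord, Args.spine_apply, Term.spine] at hs
    | cons b w' =>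
      simp only [prependWord, List.foldr_cons, Term.app.injEq, heq_eq_eq, true_and,
        Term.terminal.injEq, WordTerminal.letter.injEq] at h
      obtain ⟨hw, hF⟩ := ih h.2
      exact ⟨by rw [h.1, hw], hF⟩

theorem prependWord_endMarker_ne {A : Type*} {N : Kind → Type*} {w w' : List A} {κ : Kind}
    {F : N κ} {l : Args N (WordTerminal A) κ} :
    prependWord w (.terminal .endMarker) ≠ prependWord w' (l.apply (.nonterminal F)) := by
  intro h
  induction w generalizing w' with
  | nil =>
    cases w' with
    | nil =>
      have hs := congrArg (fun t => Term.spine t .nil) h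
      simp [prependWord, Args.spine_apply, Term.spine] at hs
    | cons a w' => simp [prependWord] at h
  | cons a w ih =>
    cases w' with
    | nil =>
      have hs := congrArg (fun t => Term.spine t .nil) h
      simp [prependWord, Args.spine_apply, Term.spine] at hs
    | cons b w' =>
      simp only [prependWord, List.foldr_cons, Term.app.injEq, heq_eq_eq, true_and] at h
      exact ih h.2

theorem prependWord_endMarker_injective {A : Type*} {N : Kind → Type*} {w w' : List A}
    (h : (prependWord w (.terminal .endMarker) : Term N (WordTerminal A) [] .ground) =
      prependWord w' (.terminal .endMarker)) : w = w' := by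
  induction w generalizing w' with
  | nil =>
    cases w' with
    | nil => rfl
    | cons a w' => simp [prependWord] at h
  | cons a w ih =>
    cases w' with
    | nil => simp [prependWord] at h
    | cons b w' =>
      simp only [prependWord, List.foldr_cons, Term.app.injEq, heq_eq_eq, true_and,
        Term.terminal.injEq, WordTerminal.letter.injEq] at h
      rw [h.1, ih h.2]

/-- A closed term is a letter or becomes, applied to arguments `t₁, …, tₙ` up to ground kind, one
of the terms `w $` and `w (F u₁ ⋯ uₘ)`. -/
theorem Term.apply_eq_prependWord_or_eq_letter {A : Type*} {N : Kind → Type*} {κ : Kind}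
    (t : Term N (WordTerminal A) [] κ) :
    (∀ l : Args N (WordTerminal A) κ, ∃ w : List A,
      l.apply t = prependWord w (.terminal .endMarker) ∨
      ∃ (κ' : Kind) (F : N κ') (l' : Args N (WordTerminal A) κ'),
        l.apply t = prependWord w (l'.apply (.nonterminal F))) ∨
    ∃ a : A, (⟨κ, t⟩ : Σ κ : Kind, Term N (WordTerminal A) [] κ) =
      ⟨_, .terminal (.letter a)⟩ := by
  induction t with
  | var x => cases x
  | nonterminal F => exact .inl fun l => ⟨[], .inr ⟨_, F, l, rfl⟩⟩
  | terminal s =>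
    cases s with
    | letter a => exact .inr ⟨a, rfl⟩
    | endMarker =>
      refine .inl fun l => ?_
      cases l
      exact ⟨[], .inl rfl⟩
  | app t u iht ihu =>
    left
    intro l
    obtain h | ⟨a, h⟩ := iht
    · exact h (.cons u l)
    · cases h
      cases l
      obtain h | ⟨b, h⟩ := ihu
      · obtain ⟨w, h | ⟨κ', F, l', h⟩⟩ := h .nil
        · exact ⟨a :: w, .inl (congrArg (fun v => prependWord [a] v) h)⟩
        · exact ⟨a :: w, .inr ⟨κ', F, l', congrArg (fun v => prependWord [a] v) h⟩⟩
      · cases h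

theorem prependWord_append_singleton {A : Type*} {N : Kind → Type*} (w : List A) (a : A)
    (t : Term N (WordTerminal A) [] .ground) :
    prependWord (w ++ [a]) t = prependWord w (.app (.terminal (.letter a)) t) :=
  List.foldr_append

/-! ### Invariants and winning strategies -/

namespace HOGame

variable {A Q : Type*} (g : HOGame A Q)

/-- An invariant: a set of positions in which Player `∃` can stay, which Player `∀` cannot
leave, and in which all terms `a₁ (⋯ (aₖ $))` are won by Player `∃`. -/
structure IsInvariant (W : Set g.Position) : Prop where
  existential : ∀ (w : List A) {κ : Kind} (F : g.G.N κ) (l : Args g.G.N (WordTerminal A) κ),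
    g.owner F = .existential → prependWord w (l.apply (.nonterminal F)) ∈ W →
      ∃ e ∈ g.G.rules F, prependWord w (e.inst l) ∈ W
  universal : ∀ (w : List A) {κ : Kind} (F : g.G.N κ) (l : Args g.G.N (WordTerminal A) κ),
    g.owner F = .universal → prependWord w (l.apply (.nonterminal F)) ∈ W →
      ∀ e ∈ g.G.rules F, prependWord w (e.inst l) ∈ W
  accepts : ∀ w : List A, prependWord w (.terminal .endMarker) ∈ W → w ∈ g.aut.accepts

variable {g}

theorem not_move_endMarker (w : List A) (t : g.Position) :
    ¬ g.Move (prependWord w (.terminal .endMarker)) t := by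
  generalize hs : (prependWord w (.terminal .endMarker) : g.Position) = s
  rintro ⟨w', F, l, e, he⟩
  exact prependWord_endMarker_ne hs

theorem Move.exists_rule {w : List A} {κ : Kind} {F : g.G.N κ}
    {l : Args g.G.N (WordTerminal A) κ} {t : g.Position}
    (h : g.Move (prependWord w (l.apply (.nonterminal F))) t) :
    ∃ e ∈ g.G.rules F, t = prependWord w (e.inst l) := by
  generalize hs : prependWord w (l.apply (.nonterminal F)) = s at h
  obtain ⟨w', F', l', e, he⟩ := h
  obtain ⟨rfl, hF⟩ := prependWord_apply_injective hs
  cases hF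
  exact ⟨e, he, rfl⟩

theorem Turn.owner_eq {p : Player} {w : List A} {κ : Kind} {F : g.G.N κ}
    {l : Args g.G.N (WordTerminal A) κ}
    (h : g.Turn p (prependWord w (l.apply (.nonterminal F)))) : g.owner F = p := by
  obtain ⟨w', κ', F', l', hp, hs⟩ := h
  obtain ⟨-, hF⟩ := prependWord_apply_injective hs
  cases hF
  exact hp

/-- The positions that a winning strategy reaches form an invariant. -/
theorem IsWinning.isInvariant {σ : g.Strategy} (hσ : g.IsWinning σ) :
    g.IsInvariant {t | ∃ h, g.Conforms σ (t :: h)} where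
  existential := by
    rintro w κ F l hF ⟨h, hh⟩
    have hm := hσ.1 _ h hh ⟨w, κ, F, l, hF, rfl⟩
    obtain ⟨e, he, hs⟩ := hm.exists_rule
    exact ⟨e, he, _, hs ▸ hh.move hm fun _ => rfl⟩
  universal := by
    rintro w κ F l hF ⟨h, hh⟩ e he
    refine ⟨_, hh.move (.rewrite w F l e he) fun ht => ?_⟩
    have := ht.owner_eq
    rw [hF] at this
    cases this
  accepts := by
    rintro w ⟨h, hh⟩
    obtain ⟨w', hw, hacc⟩ := hσ.2 _ h hh (not_move_endMarker w)
    exact prependWord_endMarker_injective hw ▸ hacc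

/-- Staying in an invariant is a winning strategy. -/
theorem IsInvariant.existentialWins (hrules : ∀ (κ : Kind) (F : g.G.N κ), g.G.rules F ≠ [])
    {W : Set g.Position} (hW : g.IsInvariant W) (hS : .nonterminal g.G.S ∈ W) :
    g.ExistentialWins := by
  classical
  let next : g.Position → g.Position := fun t =>
    if h : ∃ t', g.Move t t' ∧ t' ∈ W then h.choose else t
  have hnext : ∀ t ∈ W, g.Turn .existential t → g.Move t (next t) ∧ next t ∈ W := by
    rintro _ ht ⟨w, κ, F, l, hF, rfl⟩
    obtain ⟨e, he, hmem⟩ := hW.existential w F l hF ht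
    have h : ∃ t', g.Move (prependWord w (l.apply (.nonterminal F))) t' ∧ t' ∈ W :=
      ⟨_, .rewrite w F l e he, hmem⟩
    simp only [next, dif_pos h]
    exact h.choose_spec
  let σ : g.Strategy := fun h => next (h.headD (.nonterminal g.G.S))
  have hconf : ∀ h, g.Conforms σ h → ∀ t ∈ h, t ∈ W := by
    intro h hh
    induction hh with
    | start => simpa using hS
    | @move t t' h hh ht hσ ih =>
      have htW : t ∈ W := ih t (by simp)
      refine List.forall_mem_cons.2 ⟨?_, ih⟩
      by_cases hturn : g.Turn .existential t
      · rw [hσ hturn]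
        exact (hnext t htW hturn).2
      · obtain ⟨w, F, l, e, he⟩ := ht
        refine hW.universal w F l ?_ htW e he
        cases ho : g.owner F with
        | existential => exact absurd ⟨w, _, F, l, ho, rfl⟩ hturn
        | universal => rfl
  refine ⟨σ, fun t h hh hturn => (hnext t (hconf _ hh t (by simp)) hturn).1, ?_⟩
  intro t h hh hend
  have htW := hconf _ hh t (by simp)
  obtain ht | ⟨a, ha⟩ := t.apply_eq_prependWord_or_eq_letter
  · obtain ⟨w, hw | ⟨κ, F, l, hw⟩⟩ := ht .nil
    · change t = _ at hw
      exact ⟨w, hw, hW.accepts w (hw ▸ htW)⟩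
    · change t = _ at hw
      obtain ⟨e, he⟩ := List.exists_mem_of_ne_nil _ (hrules κ F)
      exact absurd (hw ▸ Move.rewrite w F l e he) (hend _)
  · cases ha

theorem existentialWins_iff (hrules : ∀ (κ : Kind) (F : g.G.N κ), g.G.rules F ≠ []) :
    g.ExistentialWins ↔ ∃ W, g.IsInvariant W ∧ .nonterminal g.G.S ∈ W :=
  ⟨fun ⟨_, hσ⟩ => ⟨_, hσ.isInvariant, [], .start⟩,
    fun ⟨_, hW, hS⟩ => hW.existentialWins hrules hS⟩

end HOGame

/-! ### The greatest solution is a fixed point -/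

theorem Model.isGLB_sol {T : Kind → Type*} (M : Model T) (G : DetScheme T) :
    IsGLB (Set.range (M.approx G)) (M.sol G) :=
  Classical.choose_spec (Cppo.exists_isGLB (M.approx G) (M.approx_antitone G))

theorem Model.rhs_meetCont {T : Kind → Type*} (M : Model T) (G : DetScheme T) :
    MeetCont (M.rhs G) :=
  MeetCont.pi (α := fun κ => G.N κ → Dom M.D κ) fun κ => MeetCont.pi fun F =>
    (M.semAbs κ [] (G.rhs F)).cont.comp (.prodMk .id (.const _))

theorem Model.rhs_sol {T : Kind → Type*} (M : Model T) (G : DetScheme T) :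
    M.rhs G (M.sol G) = M.sol G := by
  refine (M.rhs_meetCont G _ (M.approx_antitone G) _ (M.isGLB_sol G)).unique ⟨?_, fun b hb => ?_⟩
  · rintro _ ⟨i, rfl⟩
    exact (M.isGLB_sol G).1 ⟨i + 1, rfl⟩
  · refine (M.isGLB_sol G).2 ?_
    rintro _ ⟨i, rfl⟩
    exact (hb ⟨i, rfl⟩).trans (M.approx_antitone G i.le_succ)

/-- Over a finite ground domain, the greatest solution agrees with some approximant at any given
non-terminal of ground kind. -/
theorem Model.exists_approx_eq_sol {T : Kind → Type*} (M : Model T) [Finite M.D]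
    (G : DetScheme T) (F : G.N .ground) : ∃ i, M.sol G .ground F = M.approx G i .ground F := by
  have hev : MeetCont fun ν : NVal G.N M.D => ν .ground F :=
    (MeetCont.eval F).comp (MeetCont.eval (α := fun κ => G.N κ → Dom M.D κ) .ground)
  have hglb := hev _ (M.approx_antitone G) _ (M.isGLB_sol G)
  obtain ⟨n, hn⟩ := @exists_forall_le_of_antitone (Dom M.D .ground) _ ‹Finite M.D›
    (fun i => M.approx G i .ground F) fun i j h => M.approx_antitone G h .ground F
  refine ⟨n, le_antisymm (hglb.1 ⟨n, rfl⟩) (hglb.2 ?_)⟩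
  rintro _ ⟨i, rfl⟩
  exact hn i

/-! ### Satisfaction in the abstract model -/

namespace HOGame

variable {A Q : Type*} [Finite Q] (g : HOGame A Q)

/-- The formula `d` is true after the word `w`: it is satisfied by the set of those atoms `X` for
which the initial state has a run on `w` into `X`. -/
def SatAfter (w : List A) (d : Dom g.absModel.D .ground) : Prop :=
  FormDom.Sat {X : AccSet g.aut | g.q₀ ∈ (w.foldr (predAtom g.aut) X).1} d

variable {g}

theorem satAfter_top (w : List A) : g.SatAfter w ⊤ := trivial

theorem satAfter_letter (w : List A) (a : A) (d : Dom g.absModel.D .ground) :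
    g.SatAfter w (Dom.toContFun (g.absModel.interp (.base (.letter a))) d) ↔
      g.SatAfter (w ++ [a]) d := by
  induction d using Quotient.inductionOn with
  | h φ =>
    refine (PosForm.sat_map (predAtom g.aut a) _ φ).trans (iff_of_eq ?_)
    congr 1
    ext X
    simp

omit [Finite Q] in
theorem val_foldr_predAtom_finalAtom (w : List A) :
    (w.foldr (predAtom g.aut) (finalAtom g.aut)).1 = acceptFrom g.aut w := by
  induction w with
  | nil => exact (acceptFrom_nil g.aut).symm
  | cons a w ih =>
    rw [← predStates_acceptFrom, ← ih]
    rfl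

theorem satAfter_endMarker (w : List A) :
    g.SatAfter w (g.absModel.interp (.base .endMarker)) ↔ w ∈ g.aut.accepts := by
  change g.q₀ ∈ (w.foldr (predAtom g.aut) (finalAtom g.aut)).1 ↔ _
  rw [val_foldr_predAtom_finalAtom, NFA.mem_accepts, g.start_eq]
  rfl

end HOGame

namespace FormDom

variable {P : Type*}

theorem sat_and (I : Set P) (x y : FormDom P) : (x.and y).Sat I ↔ x.Sat I ∧ y.Sat I := by
  induction x using Quotient.inductionOn
  induction y using Quotient.inductionOn
  exact Iff.rfl

theorem sat_or (I : Set P) (x y : FormDom P) : (x.or y).Sat I ↔ x.Sat I ∨ y.Sat I := by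
  induction x using Quotient.inductionOn
  induction y using Quotient.inductionOn
  exact Iff.rfl

theorem sat_foldl_and {E : Type*} (I : Set P) (v : E → FormDom P) (x : FormDom P) (l : List E) :
    (l.foldl (fun x e => x.and (v e)) x).Sat I ↔ x.Sat I ∧ ∀ e ∈ l, (v e).Sat I := by
  induction l generalizing x with
  | nil => simp
  | cons e l ih => rw [List.foldl_cons, ih, sat_and, List.forall_mem_cons, and_assoc]

theorem sat_foldl_or {E : Type*} (I : Set P) (v : E → FormDom P) (x : FormDom P) (l : List E) :
    (l.foldl (fun x e => x.or (v e)) x).Sat I ↔ x.Sat I ∨ ∃ e ∈ l, (v e).Sat I := by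
  induction l generalizing x with
  | nil => simp
  | cons e l ih => rw [List.foldl_cons, ih, sat_or, List.exists_mem_cons_iff, or_assoc]

end FormDom

/-- An iterated binary operation applied to a list of terms is evaluated by a left fold. -/
theorem Model.sem_applyList_of_iterOp {T : Kind → Type*} {G : Scheme T}
    (M : Model (DetTerminal G)) (b : ContFun (M.D × M.D) M.D) {Γ : List Kind}
    (ν : NVal G.N M.D × Env M.D Γ) (l : List (Term G.N T Γ .ground)) (x : M.D)
    (f : Term G.N (DetTerminal G) Γ (opKind l.length))
    (hf : M.sem f ν = iterOp b l.length x) :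
    M.sem (Term.applyList l f) ν =
      l.foldl (fun x e => b (x, M.sem (κ := .ground) e.toDet ν)) x := by
  induction l generalizing x with
  | nil => exact hf
  | cons e l ih =>
    exact ih (b (x, M.sem (κ := .ground) e.toDet ν)) (.app f e.toDet)
      (congrArg (fun h => Dom.toContFun (κ₁ := .ground) (κ₂ := opKind l.length) h
        (M.sem e.toDet ν)) hf)

/-- If `op_F` is the `n`-ary version of a binary operation, the right-hand side of `F` in the
determinised scheme is evaluated by folding this operation over the values of the bodies. -/
theorem Model.sem_det_rhs {T : Kind → Type*} {G : Scheme T} (M : Model (DetTerminal G))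
    (b : ContFun (M.D × M.D) M.D) {κ : Kind} {F : G.N κ} {e : RuleBody G.N T κ}
    {l : List (RuleBody G.N T κ)} (hl : G.rules F = e :: l) (hop : M.interp (.op F) = naryOp b _)
    (ν : NVal G.N M.D × Env M.D (bodyCtx κ [])) :
    M.sem (G.det.rhs F) ν =
      l.foldl (fun x e => b (x, M.sem (κ := .ground) e.toDet ν))
        (M.sem (κ := .ground) e.toDet ν) := by
  have hf : M.sem (.terminal (.op F)) ν = naryOp b _ := hop
  change M.sem (Term.applyList (G.rules F) (.terminal (.op F))) ν = _
  -- The kind of `op_F` mentions `G.rules F`, which can be replaced by `e :: l` only after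
  -- generalizing the symbol.
  generalize (Term.terminal (.op F) : Term G.N (DetTerminal G) (bodyCtx κ []) _) = f at hf
  clear hop
  revert f
  rw [hl]
  intro f hf
  exact M.sem_applyList_of_iterOp b ν l _ (.app f e.toDet)
    (congrArg (fun h => Dom.toContFun (κ₁ := .ground) (κ₂ := opKind l.length) h
      (M.sem e.toDet ν)) hf)

namespace HOGame

variable {A Q : Type*} [Finite Q] {g : HOGame A Q}

theorem satAfter_det_rhs_universal (w : List A) {κ : Kind} {F : g.G.N κ}
    (hrules : g.G.rules F ≠ []) (hF : g.owner F = .universal)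
    (ν : NVal g.G.N g.absModel.D × Env g.absModel.D (bodyCtx κ [])) :
    g.SatAfter w (g.absModel.sem (g.G.det.rhs F) ν) ↔
      ∀ e ∈ g.G.rules F, g.SatAfter w (g.absModel.sem e.toDet ν) := by
  have hop : g.absModel.interp (.op F) = naryOp (D := FormDom (AccSet g.aut))
      ⟨fun p => p.1.and p.2, MeetCont.of_finite FormDom.and_mono⟩ _ := by
    change (match g.owner F with | .universal => _ | .existential => _) = _
    rw [hF]
  obtain ⟨e, l, hl⟩ := List.exists_cons_of_ne_nil hrules
  rw [g.absModel.sem_det_rhs _ hl hop, hl, List.forall_mem_cons]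
  exact FormDom.sat_foldl_and _ _ _ _

theorem satAfter_det_rhs_existential (w : List A) {κ : Kind} {F : g.G.N κ}
    (hrules : g.G.rules F ≠ []) (hF : g.owner F = .existential)
    (ν : NVal g.G.N g.absModel.D × Env g.absModel.D (bodyCtx κ [])) :
    g.SatAfter w (g.absModel.sem (g.G.det.rhs F) ν) ↔
      ∃ e ∈ g.G.rules F, g.SatAfter w (g.absModel.sem e.toDet ν) := by
  have hop : g.absModel.interp (.op F) = naryOp (D := FormDom (AccSet g.aut))
      ⟨fun p => p.1.or p.2, MeetCont.of_finite FormDom.or_mono⟩ _ := by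
    change (match g.owner F with | .universal => _ | .existential => _) = _
    rw [hF]
  obtain ⟨e, l, hl⟩ := List.exists_cons_of_ne_nil hrules
  rw [g.absModel.sem_det_rhs _ hl hop, hl, List.exists_mem_cons_iff]
  exact FormDom.sat_foldl_or _ _ _ _

/-! ### Values of positions -/

variable (g) in
/-- The value of a closed term of the scheme under the greatest solution. -/
noncomputable def closedSem {κ : Kind} (t : Term g.G.N (WordTerminal A) [] κ) :
    Dom g.absModel.D κ :=
  g.absModel.sem t.toDet (g.absModel.sol g.G.det, Env.empty _)

theorem closedSem_subst {Γ : List Kind} (s : ∀ κ, Var Γ κ → Term g.G.N (WordTerminal A) [] κ)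
    {κ : Kind} (t : Term g.G.N (WordTerminal A) Γ κ) :
    g.closedSem (t.subst s) =
      g.absModel.sem t.toDet (g.absModel.sol g.G.det, fun κ x => g.closedSem (s κ x)) := by
  induction t with
  | var x => rfl
  | nonterminal F => rfl
  | terminal a => rfl
  | app t u iht ihu =>
    change Dom.toContFun (g.closedSem (t.subst s)) (g.closedSem (u.subst s)) = _
    rw [iht, ihu]
    rfl

/-- Applying an abstraction to the values of closed arguments amounts to evaluating its body in
the environment that these arguments define. -/
theorem closedSem_apply_eq_sem {κ : Kind} {Γ : List Kind}
    (e : Term g.G.N (DetTerminal g.G) (bodyCtx κ Γ) .ground) (ρ : Env g.absModel.D Γ)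
    (s : ∀ κ, Var Γ κ → Term g.G.N (WordTerminal A) [] κ)
    (hs : ∀ κ x, ρ κ x = g.closedSem (s κ x))
    (l : Args g.G.N (WordTerminal A) κ) (t : Term g.G.N (WordTerminal A) [] κ)
    (ht : g.closedSem t = g.absModel.semAbs κ Γ e (g.absModel.sol g.G.det, ρ)) :
    g.closedSem (l.apply t) =
      g.absModel.sem e (g.absModel.sol g.G.det, fun κ x => g.closedSem (l.toSubst s κ x)) := by
  induction l generalizing Γ with
  | nil =>
    have hρ : ρ = fun κ x => g.closedSem (s κ x) := funext fun κ => funext (hs κ)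
    exact hρ ▸ ht
  | @cons κ₁ κ₂ u l ih =>
    refine ih (Γ := κ₁ :: Γ) e (Env.cons (g.closedSem u) ρ) _ ?_ (.app t u) ?_
    · rintro κ (_ | x)
      · rfl
      · exact hs _ x
    · exact congrArg (fun h => Dom.toContFun h (g.closedSem u)) ht

/-- The fixed point equation, read at a position with head `F`. -/
theorem closedSem_apply_nonterminal {κ : Kind} (F : g.G.N κ)
    (l : Args g.G.N (WordTerminal A) κ) :
    g.closedSem (l.apply (.nonterminal F)) = g.absModel.sem (g.G.det.rhs F)
      (g.absModel.sol g.G.det,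
        fun κ x => g.closedSem (l.toSubst (Γ := []) (fun _ x => nomatch x) κ x)) := by
  refine closedSem_apply_eq_sem (Γ := []) _ (Env.empty _) _ (fun κ x => nomatch x) l _ ?_
  exact (congrFun (congrFun (g.absModel.rhs_sol g.G.det) κ) F).symm

theorem satAfter_closedSem_prependWord (v w : List A) (t : g.Position) :
    g.SatAfter v (g.closedSem (prependWord w t)) ↔ g.SatAfter (v ++ w) (g.closedSem t) := by
  induction w generalizing v with
  | nil => rw [List.append_nil]; rfl
  | cons a w ih =>
    refine (satAfter_letter v a (g.closedSem (prependWord w t))).trans ?_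
    rw [ih, List.append_assoc]
    rfl

theorem isInvariant_satAfter_closedSem (hrules : ∀ (κ : Kind) (F : g.G.N κ), g.G.rules F ≠ []) :
    g.IsInvariant {t | g.SatAfter [] (g.closedSem t)} where
  existential := by
    intro w κ F l hF ht
    rw [Set.mem_ofPred_eq, satAfter_closedSem_prependWord, closedSem_apply_nonterminal] at ht
    replace ht := (satAfter_det_rhs_existential _ (hrules κ F) hF _).1 ht
    obtain ⟨e, he, hsat⟩ := ht
    refine ⟨e, he, ?_⟩
    rw [Set.mem_ofPred_eq, satAfter_closedSem_prependWord, RuleBody.inst, closedSem_subst]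
    exact hsat
  universal := by
    intro w κ F l hF ht e he
    rw [Set.mem_ofPred_eq, satAfter_closedSem_prependWord, closedSem_apply_nonterminal] at ht
    replace ht := (satAfter_det_rhs_universal _ (hrules κ F) hF _).1 ht
    rw [Set.mem_ofPred_eq, satAfter_closedSem_prependWord, RuleBody.inst, closedSem_subst]
    exact ht e he
  accepts := by
    intro w hw
    rw [Set.mem_ofPred_eq, satAfter_closedSem_prependWord] at hw
    exact (satAfter_endMarker w).1 hw

/-! ### The logical relation of an invariant -/

/-- The logical relation between abstract values and closed terms that an invariant `W` defines:
at ground kind, the value is satisfied after every word `w` with `w t ∈ W`; at function kind,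
related arguments are mapped to related results. -/
def Rel (W : Set g.Position) :
    ∀ κ : Kind, Dom g.absModel.D κ → Term g.G.N (WordTerminal A) [] κ → Prop
  | .ground, d, t => ∀ w : List A, prependWord w t ∈ W → g.SatAfter w d
  | .arr κ₁ κ₂, f, t => ∀ (d : Dom g.absModel.D κ₁) (u : Term g.G.N (WordTerminal A) [] κ₁),
      Rel W κ₁ d u → Rel W κ₂ (Dom.toContFun f d) (.app t u)

variable {W : Set g.Position}

theorem rel_top (κ : Kind) (t : Term g.G.N (WordTerminal A) [] κ) : Rel W κ ⊤ t := by
  induction κ with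
  | ground => exact fun w _ => satAfter_top w
  | arr κ₁ κ₂ _ ih => exact fun d u _ => ih (.app t u)

theorem rel_terminal (hW : g.IsInvariant W) {κ : Kind} (s : WordTerminal A κ) :
    Rel W κ (g.absModel.interp (.base s)) (.terminal s) := by
  cases s with
  | letter a =>
    intro d u h w hw
    refine (satAfter_letter w a d).2 (h _ ?_)
    rwa [prependWord_append_singleton]
  | endMarker => exact fun w hw => (satAfter_endMarker w).2 (hW.accepts w hw)

/-- Terms evaluate to values related to their substitution instances, if this holds for the
non-terminals and variables. -/
theorem rel_sem (hW : g.IsInvariant W) {ν : NVal g.G.N g.absModel.D}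
    (hν : ∀ (κ : Kind) (F : g.G.N κ), Rel W κ (ν κ F) (.nonterminal F)) {Γ : List Kind}
    {ρ : Env g.absModel.D Γ} {s : ∀ κ, Var Γ κ → Term g.G.N (WordTerminal A) [] κ}
    (hρ : ∀ κ x, Rel W κ (ρ κ x) (s κ x)) {κ : Kind} (t : Term g.G.N (WordTerminal A) Γ κ) :
    Rel W κ (g.absModel.sem t.toDet (ν, ρ)) (t.subst s) := by
  induction t with
  | var x => exact hρ _ x
  | nonterminal F => exact hν _ F
  | terminal a => exact rel_terminal hW a
  | app t u iht ihu => exact iht _ _ ihu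

/-- An abstraction is related to a closed term `t` if its body, evaluated at related arguments, is
related to the application of `t` to these arguments. -/
theorem rel_semAbs {ν : NVal g.G.N g.absModel.D} {κ : Kind} {Γ : List Kind}
    (e : Term g.G.N (DetTerminal g.G) (bodyCtx κ Γ) .ground) {ρ : Env g.absModel.D Γ}
    {s : ∀ κ, Var Γ κ → Term g.G.N (WordTerminal A) [] κ}
    (hρ : ∀ κ x, Rel W κ (ρ κ x) (s κ x)) (t : Term g.G.N (WordTerminal A) [] κ)
    (h : ∀ (l : Args g.G.N (WordTerminal A) κ) (ρ' : Env g.absModel.D (bodyCtx κ Γ)),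
      (∀ κ' x, Rel W κ' (ρ' κ' x) (l.toSubst s κ' x)) →
        Rel W .ground (g.absModel.sem e (ν, ρ')) (l.apply t)) :
    Rel W κ (g.absModel.semAbs κ Γ e (ν, ρ)) t := by
  induction κ generalizing Γ with
  | ground => exact h .nil ρ hρ
  | arr κ₁ κ₂ _ ih =>
    intro d u hdu
    refine ih (Γ := κ₁ :: Γ) e (ρ := Env.cons d ρ) ?_ (.app t u)
      fun l ρ' hl => h (.cons u l) ρ' hl
    rintro κ (_ | x)
    · exact hdu
    · exact hρ _ x

theorem rel_approx (hrules : ∀ (κ : Kind) (F : g.G.N κ), g.G.rules F ≠ [])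
    (hW : g.IsInvariant W) (i : ℕ) (κ : Kind) (F : g.G.N κ) :
    Rel W κ (g.absModel.approx g.G.det i κ F) (.nonterminal F) := by
  induction i generalizing κ with
  | zero => exact rel_top κ _
  | succ i ih =>
    refine rel_semAbs (Γ := []) (s := fun _ x => nomatch x) (g.G.det.rhs F) (fun _ x => nomatch x)
      (.nonterminal F) fun l ρ hρ w hw => ?_
    have hbody : ∀ e ∈ g.G.rules F, prependWord w (e.inst l) ∈ W →
        g.SatAfter w (g.absModel.sem e.toDet (g.absModel.approx g.G.det i, ρ)) :=
      fun e _ => rel_sem hW ih hρ e w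
    cases hF : g.owner F with
    | existential =>
      obtain ⟨e, he, hmem⟩ := hW.existential w F l hF hw
      exact (satAfter_det_rhs_existential w (hrules κ F) hF _).2 ⟨e, he, hbody e he hmem⟩
    | universal =>
      exact (satAfter_det_rhs_universal w (hrules κ F) hF _).2 fun e he =>
        hbody e he (hW.universal w F l hF hw e he)

end HOGame

/-! ### The winner of the game -/

theorem mainTheorem5 {A Q : Type*} [Finite A] [Finite Q] (g : HOGame A Q)
    (hrules : ∀ (κ : Kind) (F : g.G.N κ), g.G.rules F ≠ []) :
    g.absValue.Sat {X : AccSet g.aut | g.q₀ ∈ X.1} ↔ g.ExistentialWins := by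
  rw [HOGame.existentialWins_iff hrules]
  change g.SatAfter [] (g.absModel.sol g.G.det .ground g.G.S) ↔ _
  constructor
  · exact fun h => ⟨_, HOGame.isInvariant_satAfter_closedSem hrules, h⟩
  · rintro ⟨W, hW, hS⟩
    have : Finite g.absModel.D := inferInstanceAs (Finite (FormDom (AccSet g.aut)))
    obtain ⟨i, hi⟩ := g.absModel.exists_approx_eq_sol g.G.det g.G.S
    rw [hi]
    exact HOGame.rel_approx hrules hW i .ground g.G.S [] hS
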